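/- Let $N\ge 1$, let $\kappa_M\ge 1$ be real, and let $\|\cdot\|$ be a unitarily invariant norm on $\mathbb C^{N\times N}$, i.e. a norm with $\|UAV\|=\|A\|$ for all unitary $U,V$. Then there is a unique symmetric gauge function $g$ on $\mathbb R^N$ (a norm invariant under permutations of the entries and under replacing entries by their absolute values) such that $\|A\|=g(\sigma_1(A),\dots,\sigma_N(A))$ for every $A$, where $\sigma_i(A)$ are the singular values of $A$; it is called the gauge function of $\|\cdot\|$. Let $S\in\mathbb C^{N\times N}$ be positive semidefinite Hermitian, with spectral decomposition $S=U_S\,\mathrm{diag}(d_1,\dots,d_N)\,U_S^\dagger$, $U_S$ unitary, $d_1\ge\dots\ge d_N$. For $u\ge 1/\kappa_M$ put $\lambda_i^\star(u)=\min\bigl(\kappa_M u,\max(d_i,\max(1,u))\bigr)$ and $h_i(u)=|\lambda_i^\star(u)-d_i|$, $i=1,\dots,N$. Then the function $u\mapsto g(h_1(u),\dots,h_N(u))$ is convex on $[1/\kappa_M,\infty)$, and it has a smallest minimizer $u^\star$ there. Moreover, the matrix $$X^\star=U_S\,\mathrm{diag}\bigl(\lambda_1^\star(u^\star),\dots,\lambda_N^\star(u^\star)\bigr)\,U_S^\dagger$$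 is an optimal solution of the problem $$\mathcal P_1:\quad \min_X\ \|X-S\|\quad\text{subject to}\quad X=X^\dagger,\quad X\succeq I,\quad \frac{\lambda_{\max}(X)}{\lambda_{\min}(X)}\le\kappa_M .$$ This solution is a shrinkage estimate: it is positive semidefinite, and there are reals $e_1,\dots,e_N$ with $X^\star=U\,\mathrm{diag}(e_1,\dots,e_N)\,U^\dagger$ for every spectral decomposition $S=U\,\mathrm{diag}(d_1,\dots,d_N)\,U^\dagger$ with $U$ unitary and $d_1\ge\dots\ge d_N$. -/

import Mathlib

open scoped Matrix ComplexOrder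

/-- A norm on the complex vector space of `N × N` complex matrices (a seminorm that vanishes only
at `0`) which is unitarily invariant: `‖U A V‖ = ‖A‖` for all unitary `U`, `V`. -/
structure IsUnitarilyInvariantNorm {N : ℕ} (ν : Seminorm ℂ (Matrix (Fin N) (Fin N) ℂ)) :
    Prop where
  eq_zero : ∀ A, ν A = 0 → A = 0
  invariant : ∀ U ∈ Matrix.unitaryGroup (Fin N) ℂ, ∀ V ∈ Matrix.unitaryGroup (Fin N) ℂ,
    ∀ A, ν (U * A * V) = ν A

/-- A symmetric gauge function on `ℝ^N`: a norm that is invariant under taking absolute values of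
the entries and under permutations of the entries. -/
structure IsSymmetricGauge {N : ℕ} (g : Seminorm ℝ (Fin N → ℝ)) : Prop where
  eq_zero : ∀ x, g x = 0 → x = 0
  absolute : ∀ x, g (fun i => |x i|) = g x
  symmetric : ∀ (π : Equiv.Perm (Fin N)) (x : Fin N → ℝ), g (fun i => x (π i)) = g x

/-- The vector of the `N` singular values of a matrix, in decreasing order. -/
noncomputable def singularValueVector {N : ℕ} (A : Matrix (Fin N) (Fin N) ℂ) : Fin N → ℝ :=
  fun i => (Matrix.toEuclideanLin A).singularValues i

/-- `g` is the gauge function associated with `ν`: a symmetric gauge function such that the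
norm of every matrix is `g` of its singular values. -/
structure IsGaugeFunctionOf {N : ℕ} (ν : Seminorm ℂ (Matrix (Fin N) (Fin N) ℂ))
    (g : Seminorm ℝ (Fin N → ℝ)) : Prop where
  gauge : IsSymmetricGauge g
  norm_eq : ∀ A, ν A = g (singularValueVector A)

/-- `S = U diag(d) Uᴴ` with `U` unitary and `d` real and decreasing. -/
structure IsSpectralDecomposition {N : ℕ} (S U : Matrix (Fin N) (Fin N) ℂ) (d : Fin N → ℝ) :
    Prop where
  unitary : U ∈ Matrix.unitaryGroup (Fin N) ℂ
  antitone : Antitone d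
  eq : S = U * Matrix.diagonal (fun i => (d i : ℂ)) * Uᴴ

/-- Largest eigenvalue of a Hermitian matrix. -/
noncomputable def maxEigenvalue {N : ℕ} (X : Matrix (Fin N) (Fin N) ℂ) : ℝ :=
  sSup (spectrum ℝ X)

/-- Smallest eigenvalue of a Hermitian matrix. -/
noncomputable def minEigenvalue {N : ℕ} (X : Matrix (Fin N) (Fin N) ℂ) : ℝ :=
  sInf (spectrum ℝ X)

/-- The feasible set of the projection problem: Hermitian matrices `X` with `X ⪰ I` and
`λ_max(X) / λ_min(X) ≤ κ`. (`PosSemidef` contains that `X - 1`, hence `X`, is Hermitian.) -/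
def feasibleMatrices (N : ℕ) (κ : ℝ) : Set (Matrix (Fin N) (Fin N) ℂ) :=
  {X | (X - 1).PosSemidef ∧ maxEigenvalue X / minEigenvalue X ≤ κ}

/-- `X` is an optimal solution of: minimize `‖X - S‖` subject to `X ⪰ I`, `cond(X) ≤ κ`. -/
def IsProjectionSolution {N : ℕ} (ν : Seminorm ℂ (Matrix (Fin N) (Fin N) ℂ)) (κ : ℝ)
    (S X : Matrix (Fin N) (Fin N) ℂ) : Prop :=
  X ∈ feasibleMatrices N κ ∧ IsMinOn (fun Y => ν (Y - S)) (feasibleMatrices N κ) X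

/-- `λ_i*(u) = min(κ u, max(d_i, max(1, u)))`. -/
noncomputable def shrunkEigenvalues {N : ℕ} (κ : ℝ) (d : Fin N → ℝ) (u : ℝ) : Fin N → ℝ :=
  fun i => min (κ * u) (max (d i) (max 1 u))

/-- `g(h_1(u), …, h_N(u))` with `h_i(u) = |λ_i*(u) - d_i|`. -/
noncomputable def scalarObjective {N : ℕ} (g : Seminorm ℝ (Fin N → ℝ)) (κ : ℝ) (d : Fin N → ℝ)
    (u : ℝ) : ℝ :=
  g (fun i => |shrunkEigenvalues κ d u i - d i|)

/-- The set of minimizers over `u ≥ 1/κ` of the one-dimensional objective. -/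
def scalarSolutions {N : ℕ} (g : Seminorm ℝ (Fin N → ℝ)) (κ : ℝ) (d : Fin N → ℝ) : Set ℝ :=
  {u | u ∈ Set.Ici (1 / κ) ∧ IsMinOn (scalarObjective g κ d) (Set.Ici (1 / κ)) u}

/-- `X` is a shrinkage estimate based on `S`: it is positive semidefinite and has the same
eigenvectors as `S`, only the eigenvalues being transformed. It is required that one vector `e` of
new eigenvalues serves for every choice of an eigenvector matrix `U` of `S`. -/
def IsShrinkageEstimate {N : ℕ} (S X : Matrix (Fin N) (Fin N) ℂ) : Prop :=
  X.PosSemidef ∧ ∃ e : Fin N → ℝ, ∀ U d, IsSpectralDecomposition S U d →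
    X = U * Matrix.diagonal (fun i => (e i : ℂ)) * Uᴴ

/-! Unitary invariance allows working in an eigenbasis of `S`. There, deleting the off-diagonal
entries of `Y - S` does not increase the norm (`diagonal_diag_le`), and the diagonal of a feasible
`Y` lies in `[u, κ u]` with `u = λ_min(Y) ≥ 1` (`exists_diag_mem_Icc_of_mem_feasibleMatrices`). Each
diagonal entry of `Y - S` is thus at least the distance from `d i` to that interval, which is
`h_i(u)`. Gauge functions are monotone (`IsSymmetricGauge.mono`), so `‖Y - S‖ ≥ g(h(u))`.

Conversely, every `u ≥ 1/κ` yields a feasible matrix attaining `g(h(u))`, so the matrix problem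
reduces to the scalar one. The latter is convex because each `h_i` is a maximum of convex functions
of `u` and `g` is convex and monotone; coercivity and continuity give a smallest minimizer. -/

/-! ### Monotonicity and continuity of symmetric gauge functions -/

namespace IsSymmetricGauge

variable {N : ℕ} {g : Seminorm ℝ (Fin N → ℝ)}

theorem eq_of_abs_eq (hg : IsSymmetricGauge g) {x y : Fin N → ℝ} (h : ∀ i, |x i| = |y i|) :
    g x = g y := by
  rw [← hg.absolute x, ← hg.absolute y, funext h]

/-- Coordinates are changed one at a time: `x a` is a convex combination of `±|y a|`, and both
replacements have the same gauge by absolute invariance. -/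
theorem mono (hg : IsSymmetricGauge g) {x y : Fin N → ℝ} (h : ∀ i, |x i| ≤ |y i|) :
    g x ≤ g y := by
  suffices H : ∀ (s : Finset (Fin N)) (x : Fin N → ℝ), (∀ i, |x i| ≤ |y i|) →
      (∀ i ∉ s, |x i| = |y i|) → g x ≤ g y from H Finset.univ x h (by simp)
  intro s
  induction s using Finset.induction_on with
  | empty => exact fun x _ hx => (hg.eq_of_abs_eq fun i => hx i (by simp)).le
  | insert a s _ ih =>
    intro x hx hs
    have key : ∀ c : ℝ, |c| = |y a| → g (Function.update x a c) ≤ g y := by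
      intro c hc
      apply ih
      · intro i
        by_cases hi : i = a
        · subst hi; simp [hc]
        · simp [hi, hx i]
      · intro i his
        by_cases hi : i = a
        · subst hi; simp [hc]
        · simp [hi, hs i (by simp [hi, his])]
    have hseg : x a ∈ segment ℝ (-|y a|) |y a| := by
      rw [segment_eq_Icc (by linarith [abs_nonneg (y a)])]
      exact abs_le.mp (hx a)
    obtain ⟨p, q, hp, hq, hpq, hxa⟩ := hseg
    have hx' : x = p • Function.update x a (-|y a|) + q • Function.update x a |y a| := by
      ext i
      by_cases hi : i = a
      · subst hi; simpa using hxa.symm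
      · simp [hi, ← add_mul, hpq]
    calc g x ≤ g (p • Function.update x a (-|y a|)) + g (q • Function.update x a |y a|) := by
          conv_lhs => rw [hx']
          exact map_add_le_add _ _ _
      _ = p * g (Function.update x a (-|y a|)) + q * g (Function.update x a |y a|) := by
          rw [map_smul_eq_mul, map_smul_eq_mul, Real.norm_of_nonneg hp, Real.norm_of_nonneg hq]
      _ ≤ p * g y + q * g y := by
          gcongr
          · exact key _ (by simp)
          · exact key _ (by simp)
      _ = g y := by rw [← add_mul, hpq, one_mul]

theorem continuous (g : Seminorm ℝ (Fin N → ℝ)) : Continuous g := by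
  rw [← continuousOn_univ]
  exact g.convexOn.continuousOn isOpen_univ

end IsSymmetricGauge

/-! ### The scalar problem -/

/-- For `u ≥ 1/κ` one has `max 1 u ≤ κ u`, so the shrunk value is the projection of `d` onto `[max 1
u, κ u]`. The distance formula makes convexity in `u` visible. -/
theorem shrunkEigenvalue_eq {κ d u : ℝ} (hκ : 1 ≤ κ) (hu : u ∈ Set.Ici (1 / κ)) :
    |min (κ * u) (max d (max 1 u)) - d| = max 0 (max (d - κ * u) (max 1 u - d)) := by
  have h0 : 0 < κ := by linarith
  have h1 : 1 ≤ κ * u := by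
    have := (div_le_iff₀ h0).1 (Set.mem_Ici.1 hu)
    linarith
  have hu0 : 0 < u := lt_of_lt_of_le (by positivity) (Set.mem_Ici.1 hu)
  have h2 : max 1 u ≤ κ * u := max_le h1 (by nlinarith)
  generalize max 1 u = a at *
  generalize κ * u = b at *
  grind

theorem convexOn_eigenvalueDistance (κ d : ℝ) (s : Set ℝ) (hs : Convex ℝ s) :
    ConvexOn ℝ s fun u => max 0 (max (d - κ * u) (max 1 u - d)) := by
  have hlin : ConvexOn ℝ s fun u : ℝ => d - κ * u := by
    refine ⟨hs, fun x _ y _ a b _ _ hab => le_of_eq ?_⟩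
    simp only [smul_eq_mul]
    linear_combination -d * hab
  have hmax : ConvexOn ℝ s fun u : ℝ => max 1 u - d :=
    (((convexOn_const (1 : ℝ) hs).sup (convexOn_id hs)).sub (concaveOn_const d hs))
  exact (convexOn_const (0 : ℝ) hs).sup (hlin.sup hmax)

theorem scalarObjective_eq {N : ℕ} (g : Seminorm ℝ (Fin N → ℝ)) {κ : ℝ} (hκ : 1 ≤ κ)
    (d : Fin N → ℝ) {u : ℝ} (hu : u ∈ Set.Ici (1 / κ)) :
    scalarObjective g κ d u = g fun i => max 0 (max (d i - κ * u) (max 1 u - d i)) := by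
  unfold scalarObjective shrunkEigenvalues
  congr 1
  ext i
  exact shrunkEigenvalue_eq hκ hu

theorem convexOn_scalarObjective {N : ℕ} {g : Seminorm ℝ (Fin N → ℝ)} (hg : IsSymmetricGauge g)
    {κ : ℝ} (hκ : 1 ≤ κ) (d : Fin N → ℝ) :
    ConvexOn ℝ (Set.Ici (1 / κ)) (scalarObjective g κ d) := by
  refine ⟨convex_Ici _, fun x hx y hy a b ha hb hab => ?_⟩
  rw [scalarObjective_eq g hκ d hx, scalarObjective_eq g hκ d hy,
    scalarObjective_eq g hκ d (convex_Ici _ hx hy ha hb hab)]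
  refine le_trans (hg.mono fun i => ?_) (g.convexOn.2 (Set.mem_univ _) (Set.mem_univ _) ha hb hab)
  have := (convexOn_eigenvalueDistance κ (d i) _ (convex_Ici _)).2 hx hy ha hb hab
  rw [abs_of_nonneg (le_max_left _ _)]
  exact this.trans (le_abs_self _)

theorem continuous_scalarObjective {N : ℕ} (g : Seminorm ℝ (Fin N → ℝ)) (κ : ℝ)
    (d : Fin N → ℝ) : Continuous (scalarObjective g κ d) := by
  refine (IsSymmetricGauge.continuous g).comp (continuous_pi fun i => ?_)
  unfold shrunkEigenvalues
  fun_prop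

theorem exists_isLeast_scalarSolutions {N : ℕ} (hN : 0 < N) {g : Seminorm ℝ (Fin N → ℝ)}
    (hg : IsSymmetricGauge g) {κ : ℝ} (hκ : 1 ≤ κ) (d : Fin N → ℝ) :
    ∃ u, IsLeast (scalarSolutions g κ d) u := by
  set f := scalarObjective g κ d with hf
  have hcont : Continuous f := continuous_scalarObjective g κ d
  let i₀ : Fin N := ⟨0, hN⟩
  set c := g (Pi.single i₀ 1) with hc
  have hcpos : 0 < c := by
    refine lt_of_le_of_ne (apply_nonneg _ _) fun h => ?_
    simpa using congrFun (hg.eq_zero _ h.symm) i₀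
  -- Coercivity: a single coordinate already forces linear growth, by monotonicity of `g`.
  have hcoer : ∀ u ∈ Set.Ici (1 / κ), (u - d i₀) * c ≤ f u := by
    intro u hu
    rcases le_total u (d i₀) with h | h
    · exact le_trans (mul_nonpos_of_nonpos_of_nonneg (by linarith) hcpos.le) (apply_nonneg _ _)
    · rw [hf, scalarObjective_eq g hκ d hu]
      have : (u - d i₀) * c = g ((u - d i₀) • Pi.single i₀ 1) := by
        rw [map_smul_eq_mul, Real.norm_of_nonneg (by linarith)]
      rw [this]
      refine hg.mono fun i => ?_
      by_cases hi : i = i₀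
      · subst hi
        simp only [Pi.smul_apply, Pi.single_eq_same, smul_eq_mul, mul_one]
        rw [abs_of_nonneg (by linarith), abs_of_nonneg (le_max_left _ _)]
        exact le_max_of_le_right (le_max_of_le_right (by linarith [le_max_right 1 u]))
      · simp [hi]
  -- Beyond `R` the linear lower bound is at least `f (1 / κ)`, so a minimizer on `[1/κ, R]` is
  -- global.
  set R := max (1 / κ) (d i₀ + f (1 / κ) / c) with hR
  obtain ⟨u₀, hu₀, hmin⟩ := isCompact_Icc.exists_isMinOn
    (Set.nonempty_Icc.2 (le_max_left (1 / κ) _ : 1 / κ ≤ R)) hcont.continuousOn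
  have hu₀min : IsMinOn f (Set.Ici (1 / κ)) u₀ := by
    intro v hv
    rcases le_total v R with h | h
    · exact hmin ⟨hv, h⟩
    · change f u₀ ≤ f v
      have h1 : f u₀ ≤ f (1 / κ) := hmin (Set.left_mem_Icc.2 (le_max_left _ _))
      refine h1.trans ?_
      refine le_trans ?_ (hcoer v hv)
      have : f (1 / κ) / c ≤ v - d i₀ := by linarith [le_max_right (1 / κ) (d i₀ + f (1 / κ) / c)]
      exact (div_le_iff₀ hcpos).1 this
  have hset : scalarSolutions g κ d = Set.Ici (1 / κ) ∩ {u | f u ≤ f u₀} := by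
    ext u
    refine ⟨fun h => ⟨h.1, h.2 hu₀.1⟩, fun h => ⟨h.1, fun v hv => ?_⟩⟩
    have h1 : f u₀ ≤ f v := hu₀min hv
    exact le_trans h.2 h1
  have hclosed : IsClosed (scalarSolutions g κ d) := by
    rw [hset]
    exact isClosed_Ici.inter (isClosed_le hcont continuous_const)
  have hbdd : BddBelow (scalarSolutions g κ d) := ⟨1 / κ, fun u h => h.1⟩
  exact ⟨_, hclosed.csInf_mem ⟨u₀, hu₀.1, hu₀min⟩ hbdd, fun u h => csInf_le hbdd h⟩

/-! ### Uniqueness of eigenvalues, and singular values -/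

theorem exists_perm_comp_eq_of_map_eq {n : ℕ} {α : Type*} [LinearOrder α] {f g : Fin n → α}
    (h : Finset.univ.val.map f = Finset.univ.val.map g) :
    ∃ π : Equiv.Perm (Fin n), f = g ∘ π := by
  have hperm : (List.ofFn f).Perm (List.ofFn g) := by
    rwa [Fin.univ_val_map, Fin.univ_val_map, Multiset.coe_eq_coe] at h
  have hsort : f ∘ Tuple.sort f = g ∘ Tuple.sort g :=
    List.ofFn_injective <|
      (((Tuple.sort f).ofFn_comp_perm f).trans
        (hperm.trans ((Tuple.sort g).ofFn_comp_perm g).symm)).eq_of_sortedLE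
          (Tuple.monotone_sort f).sortedLE_ofFn (Tuple.monotone_sort g).sortedLE_ofFn
  refine ⟨(Tuple.sort f).symm.trans (Tuple.sort g), funext fun i => ?_⟩
  simpa using congrFun hsort ((Tuple.sort f).symm i)

/-- Both diagonals list the roots of the same characteristic polynomial, with multiplicity. -/
theorem exists_perm_of_conj_diagonal_eq {N : ℕ} {U V : Matrix (Fin N) (Fin N) ℂ}
    (hU : U ∈ Matrix.unitaryGroup (Fin N) ℂ) (hV : V ∈ Matrix.unitaryGroup (Fin N) ℂ)
    {a b : Fin N → ℝ}
    (h : U * Matrix.diagonal (fun i => (a i : ℂ)) * Uᴴ =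
      V * Matrix.diagonal (fun i => (b i : ℂ)) * Vᴴ) :
    ∃ π : Equiv.Perm (Fin N), a = b ∘ π := by
  have key : ∀ {W : Matrix (Fin N) (Fin N) ℂ} (_ : W ∈ Matrix.unitaryGroup (Fin N) ℂ)
      (c : Fin N → ℝ), (W * Matrix.diagonal (fun i => (c i : ℂ)) * Wᴴ).charpoly.roots =
        Finset.univ.val.map fun i => (c i : ℂ) := by
    intro W hW c
    have hW' : Wᴴ * W = 1 := (Unitary.mem_iff.1 hW).1
    rw [Matrix.charpoly_mul_comm, ← mul_assoc, hW', one_mul, Matrix.charpoly_diagonal,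
      Polynomial.roots_prod]
    · simp
    · simp [Finset.prod_ne_zero_iff, Polynomial.X_sub_C_ne_zero]
  have h2 := (key hU a).symm.trans ((congrArg (fun M => M.charpoly.roots) h).trans (key hV b))
  have h3 := congrArg (Multiset.map Complex.re) h2
  exact exists_perm_comp_eq_of_map_eq (by simpa [Multiset.map_map, Function.comp_def] using h3)

theorem IsSpectralDecomposition.eigenvalues_unique {N : ℕ} {S U V : Matrix (Fin N) (Fin N) ℂ}
    {a b : Fin N → ℝ} (hU : IsSpectralDecomposition S U a) (hV : IsSpectralDecomposition S V b) :
    a = b := by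
  obtain ⟨π, rfl⟩ := exists_perm_of_conj_diagonal_eq hU.unitary hV.unitary (hU.eq.symm.trans hV.eq)
  exact Tuple.unique_antitone (σ := π) (τ := 1) hU.antitone hV.antitone

/-- Eigenvectors `b i` of `T* T` have orthogonal images of length `σ i`; the nonzero images are
normalized and completed to an orthonormal basis `c`, which gives `T (b i) = σ i • c i`. -/
theorem exists_singularValueDecomposition {N : ℕ} (A : Matrix (Fin N) (Fin N) ℂ) :
    ∃ W ∈ Matrix.unitaryGroup (Fin N) ℂ, ∃ V ∈ Matrix.unitaryGroup (Fin N) ℂ,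
      A = W * Matrix.diagonal (fun i => (singularValueVector A i : ℂ)) * Vᴴ := by
  set T := Matrix.toEuclideanLin A with hT
  have hn : Module.finrank ℂ (EuclideanSpace ℂ (Fin N)) = N := by simp
  set σ := singularValueVector A with hσ
  let b := T.isSymmetric_adjoint_comp_self.eigenvectorBasis hn
  have hb : ∀ i, (LinearMap.adjoint T) (T (b i)) = ((σ i ^ 2 : ℝ) : ℂ) • b i := by
    intro i
    have := T.isSymmetric_adjoint_comp_self.apply_eigenvectorBasis hn i
    rw [← T.sq_singularValues_fin hn] at this
    exact this
  have hinner : ∀ i j, inner ℂ (T (b i)) (T (b j)) = if i = j then ((σ i ^ 2 : ℝ) : ℂ) else 0 := by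
    intro i j
    rw [← LinearMap.adjoint_inner_right, hb, inner_smul_right,
      orthonormal_iff_ite.1 b.orthonormal i j]
    split_ifs with h
    · subst h; simp
    · simp
  let s : Set (Fin N) := {i | σ i ≠ 0}
  let v : Fin N → EuclideanSpace ℂ (Fin N) := fun i => ((σ i : ℂ)⁻¹) • T (b i)
  have hv : Orthonormal ℂ (s.domRestrict v) := by
    rw [orthonormal_iff_ite]
    rintro ⟨i, hi⟩ ⟨j, hj⟩
    have hi' : (σ i : ℂ) ≠ 0 := Complex.ofReal_ne_zero.2 hi
    simp only [Set.domRestrict_apply, v, inner_smul_left, inner_smul_right, hinner, Subtype.mk.injEq]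
    split_ifs with h
    · subst h
      simp only [map_inv₀, Complex.conj_ofReal]
      push_cast
      field_simp
    · simp
  obtain ⟨c, hc⟩ := hv.exists_orthonormalBasis_extension_of_card_eq (by simp)
  have hTb : ∀ i, T (b i) = (σ i : ℂ) • c i := by
    intro i
    by_cases hi : σ i = 0
    · have : inner ℂ (T (b i)) (T (b i)) = 0 := (hinner i i).trans (by simp [hi])
      rw [inner_self_eq_zero.1 this, hi]; simp
    · rw [hc i hi]
      simp [v, smul_smul, hi]
  let e := EuclideanSpace.basisFun (Fin N) ℂ
  have hWm := e.toMatrix_orthonormalBasis_mem_unitary c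
  have hVm := e.toMatrix_orthonormalBasis_mem_unitary b
  refine ⟨_, hWm, _, hVm, ?_⟩
  have hmul : A * e.toBasis.toMatrix b =
      e.toBasis.toMatrix c * Matrix.diagonal (fun i => (σ i : ℂ)) := by
    ext j i
    have := congrArg (fun w : EuclideanSpace ℂ (Fin N) => w j) (hTb i)
    simp only [hT, Matrix.toLpLin_apply, PiLp.smul_apply, smul_eq_mul] at this
    rw [Matrix.mul_diagonal, mul_comm]
    simpa [Matrix.mul_apply, Matrix.mulVec, dotProduct, Module.Basis.toMatrix_apply, e] using this
  rw [← hmul, mul_assoc]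
  have : e.toBasis.toMatrix b * (e.toBasis.toMatrix b)ᴴ = 1 := (Unitary.mem_iff.1 hVm).2
  rw [this, mul_one]

/-- The squares of the singular values and of the `x i` are both the eigenvalues of `Aᴴ * A`. -/
theorem exists_perm_singularValueVector_diagonal {N : ℕ} (x : Fin N → ℝ) :
    ∃ π : Equiv.Perm (Fin N),
      ∀ i, |singularValueVector (Matrix.diagonal fun i => (x i : ℂ)) i| = |x (π i)| := by
  set A : Matrix (Fin N) (Fin N) ℂ := Matrix.diagonal fun i => (x i : ℂ) with hA
  set σ := singularValueVector A with hσ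
  obtain ⟨W, hW, V, hV, h⟩ := exists_singularValueDecomposition A
  have hW' : Wᴴ * W = 1 := (Unitary.mem_iff.1 hW).1
  have h1 : Aᴴ * A = V * Matrix.diagonal (fun i => ((σ i ^ 2 : ℝ) : ℂ)) * Vᴴ := by
    rw [← hσ] at h
    rw [h]
    simp only [Matrix.conjTranspose_mul, Matrix.conjTranspose_conjTranspose,
      Matrix.diagonal_conjTranspose]
    calc _ = V * (Matrix.diagonal (star fun i => (σ i : ℂ)) * ((Wᴴ * W) *
          Matrix.diagonal fun i => (σ i : ℂ))) * Vᴴ := by simp only [mul_assoc]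
      _ = _ := by
        rw [hW', one_mul, Matrix.diagonal_mul_diagonal]
        congr 3
        ext i
        simp [sq]
  have h2 : Aᴴ * A = 1 * Matrix.diagonal (fun i => ((x i ^ 2 : ℝ) : ℂ)) * 1ᴴ := by
    rw [hA, Matrix.diagonal_conjTranspose, Matrix.diagonal_mul_diagonal]
    simp [sq]
  obtain ⟨π, hπ⟩ := exists_perm_of_conj_diagonal_eq hV (one_mem _) (h1.symm.trans h2)
  exact ⟨π, fun i => (sq_eq_sq_iff_abs_eq_abs _ _).1 (congrFun hπ i)⟩

/-! ### The gauge function of a unitarily invariant norm, and pinching -/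

theorem diagonal_mem_unitaryGroup_of_sq_eq_one {N : ℕ} {ε : Fin N → ℝ} (hε : ∀ i, ε i * ε i = 1) :
    Matrix.diagonal (fun i => (ε i : ℂ)) ∈ Matrix.unitaryGroup (Fin N) ℂ := by
  rw [Matrix.mem_unitaryGroup_iff, Matrix.star_eq_conjTranspose, Matrix.diagonal_conjTranspose,
    Matrix.diagonal_mul_diagonal, ← Matrix.diagonal_one]
  congr 1
  ext i
  simp only [Pi.star_apply, RCLike.star_def, Complex.conj_ofReal]
  exact_mod_cast hε i

theorem conjTranspose_mem_unitaryGroup {N : ℕ} {U : Matrix (Fin N) (Fin N) ℂ}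
    (hU : U ∈ Matrix.unitaryGroup (Fin N) ℂ) : Uᴴ ∈ Matrix.unitaryGroup (Fin N) ℂ :=
  Unitary.star_mem hU

theorem permMatrix_mem_unitaryGroup {N : ℕ} (π : Equiv.Perm (Fin N)) :
    π.permMatrix ℂ ∈ Matrix.unitaryGroup (Fin N) ℂ := by
  rw [Matrix.mem_unitaryGroup_iff, Matrix.star_eq_conjTranspose, Matrix.conjTranspose_permMatrix,
    ← Matrix.permMatrix_mul]
  simp

theorem permMatrix_mul_diagonal_mul {N : ℕ} (π : Equiv.Perm (Fin N)) (x : Fin N → ℂ) :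
    π.permMatrix ℂ * Matrix.diagonal x * (π.permMatrix ℂ)ᴴ =
      Matrix.diagonal fun i => x (π i) := by
  rw [Matrix.conjTranspose_permMatrix]
  have h : π.permMatrix ℂ * Matrix.diagonal x =
      (Matrix.diagonal fun i => x (π i)) * π.permMatrix ℂ := by
    ext i j
    rw [Matrix.mul_diagonal, Matrix.diagonal_mul]
    by_cases h : π i = j
    · subst h; simp [Equiv.Perm.permMatrix, PEquiv.toMatrix_apply]
    · simp [Equiv.Perm.permMatrix, PEquiv.toMatrix_apply, h]
  rw [h, mul_assoc, ← Matrix.permMatrix_mul]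
  simp

namespace IsUnitarilyInvariantNorm

variable {N : ℕ} {ν : Seminorm ℂ (Matrix (Fin N) (Fin N) ℂ)}

/-- The restriction of a norm on matrices to real diagonal matrices. -/
noncomputable def diagonalSeminorm (ν : Seminorm ℂ (Matrix (Fin N) (Fin N) ℂ)) :
    Seminorm ℝ (Fin N → ℝ) :=
  Seminorm.of (fun x => ν (Matrix.diagonal fun i => (x i : ℂ)))
    (fun x y => by
      refine le_trans (le_of_eq ?_) (map_add_le_add ν _ _)
      rw [Matrix.diagonal_add]
      simp)
    (fun a x => by
      have : (Matrix.diagonal fun i => ((a • x) i : ℂ)) =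
          (a : ℂ) • Matrix.diagonal fun i => (x i : ℂ) := by
        rw [← Matrix.diagonal_smul]
        congr 1
        ext i
        simp
      rw [this, map_smul_eq_mul, Complex.norm_real])

theorem diagonalSeminorm_apply (x : Fin N → ℝ) :
    diagonalSeminorm ν x = ν (Matrix.diagonal fun i => (x i : ℂ)) := rfl

theorem isSymmetricGauge_diagonalSeminorm (hν : IsUnitarilyInvariantNorm ν) :
    IsSymmetricGauge (diagonalSeminorm ν) where
  eq_zero x hx := by
    have := Matrix.diagonal_eq_zero.1 (hν.eq_zero _ hx)
    ext i
    exact Complex.ofReal_eq_zero.1 (congrFun this i)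
  absolute x := by
    have hε : ∀ i, (if 0 ≤ x i then (1 : ℝ) else -1) * (if 0 ≤ x i then (1 : ℝ) else -1) = 1 := by
      intro i; split_ifs <;> norm_num
    have := hν.invariant _ (diagonal_mem_unitaryGroup_of_sq_eq_one hε) 1 (one_mem _)
      (Matrix.diagonal fun i => (x i : ℂ))
    rw [diagonalSeminorm_apply, diagonalSeminorm_apply, ← this, mul_one,
      Matrix.diagonal_mul_diagonal]
    congr 2
    ext i
    rw [← Complex.ofReal_mul]
    split_ifs with h
    · rw [abs_of_nonneg h, one_mul]
    · rw [abs_of_neg (not_le.1 h), neg_one_mul]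
  symmetric π x := by
    rw [diagonalSeminorm_apply, diagonalSeminorm_apply,
      ← permMatrix_mul_diagonal_mul π fun i => (x i : ℂ)]
    exact hν.invariant _ (permMatrix_mem_unitaryGroup π) _
      (conjTranspose_mem_unitaryGroup (permMatrix_mem_unitaryGroup π)) _

theorem isGaugeFunctionOf_diagonalSeminorm (hν : IsUnitarilyInvariantNorm ν) :
    IsGaugeFunctionOf ν (diagonalSeminorm ν) where
  gauge := hν.isSymmetricGauge_diagonalSeminorm
  norm_eq A := by
    obtain ⟨W, hW, V, hV, h⟩ := exists_singularValueDecomposition A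
    rw [diagonalSeminorm_apply]
    conv_lhs => rw [h]
    exact hν.invariant _ hW _ (conjTranspose_mem_unitaryGroup hV) _

/-- The diagonal part of a matrix has at most its norm. -/
theorem diagonal_diag_le (hν : IsUnitarilyInvariantNorm ν) (A : Matrix (Fin N) (Fin N) ℂ) :
    ν (Matrix.diagonal fun i => A i i) ≤ ν A := by
  -- `P s` is `A` with the off-diagonal entries in the rows and columns indexed by `s` deleted.
  let P : Finset (Fin N) → Matrix (Fin N) (Fin N) ℂ := fun s =>
    Matrix.of fun i j => if i = j ∨ (i ∉ s ∧ j ∉ s) then A i j else 0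
  have hP : ∀ s, ν (P s) ≤ ν A := by
    intro s
    induction s using Finset.induction_on with
    | empty =>
      refine le_of_eq (congrArg ν ?_)
      ext i j
      simp [P]
    | insert a s ha ih =>
      let ε : Fin N → ℝ := fun i => if i = a then -1 else 1
      have hε : ∀ i, ε i * ε i = 1 := by
        intro i; simp only [ε]; split_ifs <;> norm_num
      have hD := diagonal_mem_unitaryGroup_of_sq_eq_one hε
      set D : Matrix (Fin N) (Fin N) ℂ := Matrix.diagonal fun i => (ε i : ℂ) with hDdef
      -- Conjugation by `D` flips the sign of exactly the off-diagonal entries in row and column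
      -- `a`, so averaging removes them.
      have hsplit : P (insert a s) = (1 / 2 : ℂ) • P s + (1 / 2 : ℂ) • (D * P s * D) := by
        ext i j
        simp only [hDdef, P, ε, Matrix.add_apply, Matrix.smul_apply, Matrix.mul_diagonal,
          Matrix.diagonal_mul, Matrix.of_apply, smul_eq_mul, Finset.mem_insert]
        by_cases hij : i = j
        · subst hij
          by_cases hi : i = a <;> simp [hi] <;> ring
        · by_cases hi : i = a
          · have hj : j ≠ a := fun h => hij (hi.trans h.symm)
            simp only [hi, hj, Ne.symm hj]
            simp
            split_ifs <;> ring
          · by_cases hj : j = a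
            · simp [hi, hj]
            · simp [hi, hj, hij]
              split_ifs <;> ring
      calc ν (P (insert a s)) ≤ ν ((1 / 2 : ℂ) • P s) + ν ((1 / 2 : ℂ) • (D * P s * D)) := by
            rw [hsplit]; exact map_add_le_add _ _ _
        _ = ν (P s) := by
            rw [map_smul_eq_mul, map_smul_eq_mul, hν.invariant _ hD _ hD]
            norm_num
            ring
        _ ≤ ν A := ih
  refine le_trans (le_of_eq (congrArg ν ?_)) (hP Finset.univ)
  ext i j
  by_cases h : i = j
  · subst h; simp [P]
  · simp [P, h]

end IsUnitarilyInvariantNorm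

/-- This gives uniqueness: a gauge function is determined by the norm on real diagonal matrices. -/
theorem IsGaugeFunctionOf.apply_eq {N : ℕ} {ν : Seminorm ℂ (Matrix (Fin N) (Fin N) ℂ)}
    {g : Seminorm ℝ (Fin N → ℝ)} (hg : IsGaugeFunctionOf ν g) (x : Fin N → ℝ) :
    g x = ν (Matrix.diagonal fun i => (x i : ℂ)) := by
  obtain ⟨π, hπ⟩ := exists_perm_singularValueVector_diagonal x
  rw [hg.norm_eq, hg.gauge.eq_of_abs_eq hπ, hg.gauge.symmetric π x]

theorem existsUnique_isGaugeFunctionOf {N : ℕ} {ν : Seminorm ℂ (Matrix (Fin N) (Fin N) ℂ)}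
    (hν : IsUnitarilyInvariantNorm ν) : ∃! g : Seminorm ℝ (Fin N → ℝ), IsGaugeFunctionOf ν g :=
  ⟨_, hν.isGaugeFunctionOf_diagonalSeminorm, fun g hg => by
    ext x
    rw [hg.apply_eq, IsUnitarilyInvariantNorm.diagonalSeminorm_apply]⟩

/-! ### The feasible set in terms of eigenvalues -/

theorem posSemidef_conj_diagonal_iff {N : ℕ} {V : Matrix (Fin N) (Fin N) ℂ}
    (hV : V ∈ Matrix.unitaryGroup (Fin N) ℂ) (e : Fin N → ℝ) :
    (V * Matrix.diagonal (fun i => (e i : ℂ)) * Vᴴ).PosSemidef ↔ ∀ i, 0 ≤ e i := by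
  have hV' : Vᴴ * V = 1 := (Unitary.mem_iff.1 hV).1
  constructor
  · intro h i
    have h2 := h.conjTranspose_mul_mul_same V
    have h3 : Vᴴ * (V * Matrix.diagonal (fun i => (e i : ℂ)) * Vᴴ) * V =
        Matrix.diagonal (fun i => (e i : ℂ)) := by
      simp only [mul_assoc, hV', mul_one]
      rw [← mul_assoc, hV', one_mul]
    rw [h3, Matrix.posSemidef_diagonal_iff] at h2
    exact_mod_cast h2 i
  · intro h
    exact (Matrix.posSemidef_diagonal_iff.2
      fun i => by exact_mod_cast h i).mul_mul_conjTranspose_same V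

theorem conj_diagonal_sub {N : ℕ} (V : Matrix (Fin N) (Fin N) ℂ) (a b : Fin N → ℝ) :
    V * Matrix.diagonal (fun i => (a i : ℂ)) * Vᴴ -
        V * Matrix.diagonal (fun i => (b i : ℂ)) * Vᴴ =
      V * Matrix.diagonal (fun i => ((a i - b i : ℝ) : ℂ)) * Vᴴ := by
  rw [← sub_mul, ← mul_sub, Matrix.diagonal_sub]
  simp

theorem conj_diagonal_const {N : ℕ} {V : Matrix (Fin N) (Fin N) ℂ}
    (hV : V ∈ Matrix.unitaryGroup (Fin N) ℂ) (c : ℝ) :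
    V * Matrix.diagonal (fun _ => (c : ℂ)) * Vᴴ = (c : ℂ) • (1 : Matrix (Fin N) (Fin N) ℂ) := by
  have hV' : V * Vᴴ = 1 := (Unitary.mem_iff.1 hV).2
  rw [← Matrix.smul_one_eq_diagonal]
  simp [hV']

theorem spectrum_conj_diagonal {N : ℕ} {V : Matrix (Fin N) (Fin N) ℂ}
    (hV : V ∈ Matrix.unitaryGroup (Fin N) ℂ) (e : Fin N → ℝ) :
    spectrum ℝ (V * Matrix.diagonal (fun i => (e i : ℂ)) * Vᴴ) = Set.range e := by
  ext x
  rw [← spectrum.algebraMap_mem_iff ℂ]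
  have h := Unitary.spectrum_star_right_conjugate (R := ℂ)
    (a := Matrix.diagonal (fun i => (e i : ℂ))) (U := ⟨V, hV⟩)
  simp only [Matrix.star_eq_conjTranspose] at h
  rw [h, spectrum_diagonal]
  simp

theorem Matrix.IsHermitian.exists_eq_conj_diagonal {N : ℕ} {X : Matrix (Fin N) (Fin N) ℂ}
    (hX : X.IsHermitian) : ∃ V ∈ Matrix.unitaryGroup (Fin N) ℂ, ∃ e : Fin N → ℝ,
      X = V * Matrix.diagonal (fun i => (e i : ℂ)) * Vᴴ :=
  ⟨_, hX.eigenvectorUnitary.2, _, hX.spectral_theorem⟩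

theorem conj_diagonal_mem_feasibleMatrices {N : ℕ} (hN : 0 < N)
    {V : Matrix (Fin N) (Fin N) ℂ} (hV : V ∈ Matrix.unitaryGroup (Fin N) ℂ) {κ u : ℝ}
    (hu : 1 ≤ u) {e : Fin N → ℝ} {b : ℝ} (he : ∀ i, e i ∈ Set.Icc u b) (hb : b ≤ κ * u) :
    V * Matrix.diagonal (fun i => (e i : ℂ)) * Vᴴ ∈ feasibleMatrices N κ := by
  have : Nonempty (Fin N) := ⟨⟨0, hN⟩⟩
  refine ⟨?_, ?_⟩
  · have h1 := conj_diagonal_const hV 1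
    rw [Complex.ofReal_one, one_smul] at h1
    rw [← h1, ← Complex.ofReal_one, conj_diagonal_sub, posSemidef_conj_diagonal_iff hV]
    exact fun i => by linarith [(he i).1]
  · unfold maxEigenvalue minEigenvalue
    rw [spectrum_conj_diagonal hV]
    have h1 : u ≤ sInf (Set.range e) := le_csInf (Set.range_nonempty e) (by
      rintro _ ⟨i, rfl⟩; exact (he i).1)
    have h2 : sSup (Set.range e) ≤ b := csSup_le (Set.range_nonempty e) (by
      rintro _ ⟨i, rfl⟩; exact (he i).2)
    have h3 : u ≤ b := (he ⟨0, hN⟩).1.trans (he ⟨0, hN⟩).2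
    -- Needed for `b ≤ κ * u ≤ κ * sInf (Set.range e)`; a negative `κ` would contradict `0 < u ≤ b ≤
    -- κ * u`.
    have hκ : 0 ≤ κ := by
      by_contra h
      nlinarith
    rw [div_le_iff₀ (by linarith)]
    nlinarith

/-- In any orthonormal basis, the diagonal entries of a feasible matrix lie in an interval
`[u, κ u]` with `1 ≤ u`. -/
theorem exists_diag_mem_Icc_of_mem_feasibleMatrices {N : ℕ} (hN : 0 < N) {κ : ℝ}
    {Y U : Matrix (Fin N) (Fin N) ℂ} (hU : U ∈ Matrix.unitaryGroup (Fin N) ℂ)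
    (hY : Y ∈ feasibleMatrices N κ) :
    ∃ u : ℝ, 1 ≤ u ∧ ∃ y : Fin N → ℝ, ∀ i, (Uᴴ * Y * U) i i = y i ∧ y i ∈ Set.Icc u (κ * u) := by
  have : Nonempty (Fin N) := ⟨⟨0, hN⟩⟩
  have hherm : Y.IsHermitian := by
    have := hY.1.isHermitian.add Matrix.isHermitian_one
    rwa [sub_add_cancel] at this
  obtain ⟨V, hV, e, rfl⟩ := hherm.exists_eq_conj_diagonal
  have hU' : Uᴴ * U = 1 := (Unitary.mem_iff.1 hU).1
  obtain ⟨hone, hcond⟩ := hY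
  have h1 := conj_diagonal_const hV 1
  rw [Complex.ofReal_one, one_smul] at h1
  rw [← h1, ← Complex.ofReal_one, conj_diagonal_sub, posSemidef_conj_diagonal_iff hV] at hone
  unfold maxEigenvalue minEigenvalue at hcond
  rw [spectrum_conj_diagonal hV] at hcond
  set u := sInf (Set.range e) with hu
  have hu1 : 1 ≤ u := le_csInf (Set.range_nonempty e) (by
    rintro _ ⟨i, rfl⟩; linarith [hone i])
  have hlow : ∀ i, 0 ≤ e i - u := fun i =>
    sub_nonneg.2 (csInf_le (Set.finite_range e).bddBelow ⟨i, rfl⟩)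
  rw [div_le_iff₀ (by linarith)] at hcond
  have hup : ∀ i, 0 ≤ κ * u - e i := fun i =>
    sub_nonneg.2 ((le_csSup (Set.finite_range e).bddAbove ⟨i, rfl⟩).trans hcond)
  set Y := V * Matrix.diagonal (fun i => (e i : ℂ)) * Vᴴ with hYdef
  -- The bounds `u I ⪯ Y ⪯ κ u I` survive conjugation by `U`, and positive semidefinite matrices
  -- have nonnegative diagonals.
  have hl := ((posSemidef_conj_diagonal_iff hV _).2 hlow).conjTranspose_mul_mul_same U
  have hr := ((posSemidef_conj_diagonal_iff hV _).2 hup).conjTranspose_mul_mul_same U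
  rw [← conj_diagonal_sub, conj_diagonal_const hV, ← hYdef, mul_sub, sub_mul, mul_smul_comm,
    mul_one, smul_mul_assoc, hU'] at hl hr
  refine ⟨u, hu1, fun i => ((Uᴴ * Y * U) i i).re, fun i => ?_⟩
  have hli := hl.diag_nonneg (i := i)
  have hri := hr.diag_nonneg (i := i)
  simp only [Matrix.sub_apply, Matrix.smul_apply, Matrix.one_apply_eq, smul_eq_mul, mul_one,
    Complex.nonneg_iff, Complex.sub_re, Complex.sub_im, Complex.ofReal_re, Complex.ofReal_im]
    at hli hri
  refine ⟨Complex.ext rfl ?_, ?_, ?_⟩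
  · rw [Complex.ofReal_im]; linarith [hli.2]
  · linarith [hli.1]
  · linarith [hri.1]

/-! ### Shrinkage and optimality -/

/-- `Vᴴ * U` commutes with `diag(d)`, so its `(i, j)` entry vanishes unless `d i = d j`; hence it
commutes with `diag(f(d))` too. This gives independence of the choice of eigenvectors. -/
theorem conj_diagonal_comp_eq {N : ℕ} {U V : Matrix (Fin N) (Fin N) ℂ}
    (hU : U ∈ Matrix.unitaryGroup (Fin N) ℂ) (hV : V ∈ Matrix.unitaryGroup (Fin N) ℂ)
    {d : Fin N → ℝ} (f : ℝ → ℝ)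
    (h : U * Matrix.diagonal (fun i => (d i : ℂ)) * Uᴴ =
      V * Matrix.diagonal (fun i => (d i : ℂ)) * Vᴴ) :
    U * Matrix.diagonal (fun i => (f (d i) : ℂ)) * Uᴴ =
      V * Matrix.diagonal (fun i => (f (d i) : ℂ)) * Vᴴ := by
  have hU1 : Uᴴ * U = 1 := (Unitary.mem_iff.1 hU).1
  have hU2 : U * Uᴴ = 1 := (Unitary.mem_iff.1 hU).2
  have hV1 : Vᴴ * V = 1 := (Unitary.mem_iff.1 hV).1
  have hV2 : V * Vᴴ = 1 := (Unitary.mem_iff.1 hV).2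
  have key : Vᴴ * U * Matrix.diagonal (fun i => (d i : ℂ)) =
      Matrix.diagonal (fun i => (d i : ℂ)) * (Vᴴ * U) := by
    have := congrArg (fun M => Vᴴ * M * U) h
    simp only [mul_assoc, hU1, mul_one] at this
    rw [← mul_assoc Vᴴ V, hV1, one_mul] at this
    rw [mul_assoc, this]
  have key2 : Vᴴ * U * Matrix.diagonal (fun i => (f (d i) : ℂ)) =
      Matrix.diagonal (fun i => (f (d i) : ℂ)) * (Vᴴ * U) := by
    ext i j
    have hij := congrFun (congrFun key i) j
    rw [Matrix.mul_diagonal, Matrix.diagonal_mul] at hij ⊢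
    by_cases hz : (Vᴴ * U) i j = 0
    · simp [hz]
    · rw [mul_comm] at hij
      have : d j = d i := by exact_mod_cast mul_right_cancel₀ hz hij
      rw [this, mul_comm]
  have := congrArg (fun M => V * M * Uᴴ) key2
  simp only [mul_assoc, hU2, mul_one] at this
  rw [← mul_assoc V Vᴴ, hV2, one_mul] at this
  rw [mul_assoc, this, mul_assoc]

theorem shrunkEigenvalues_mem_Icc {N : ℕ} {κ u : ℝ} (hκ : 1 ≤ κ) (hu : u ∈ Set.Ici (1 / κ))
    (d : Fin N → ℝ) (i : Fin N) :
    shrunkEigenvalues κ d u i ∈ Set.Icc (max 1 u) (κ * u) := by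
  have h0 : 0 < κ := by linarith
  have h1 : 1 ≤ κ * u := by
    have := (div_le_iff₀ h0).1 (Set.mem_Ici.1 hu)
    linarith
  have hu0 : 0 < u := lt_of_lt_of_le (by positivity) (Set.mem_Ici.1 hu)
  exact ⟨le_min (max_le h1 (by nlinarith)) (le_max_right _ _), min_le_left _ _⟩

theorem isShrinkageEstimate_shrunkEigenvalues {N : ℕ} {S U : Matrix (Fin N) (Fin N) ℂ}
    {d : Fin N → ℝ} (hS : IsSpectralDecomposition S U d) {κ u : ℝ} (hκ : 1 ≤ κ)
    (hu : u ∈ Set.Ici (1 / κ)) :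
    IsShrinkageEstimate S
      (U * Matrix.diagonal (fun i => (shrunkEigenvalues κ d u i : ℂ)) * Uᴴ) := by
  refine ⟨(posSemidef_conj_diagonal_iff hS.unitary _).2 fun i => ?_,
    shrunkEigenvalues κ d u, fun V d' hV => ?_⟩
  · have := (shrunkEigenvalues_mem_Icc hκ hu d i).1
    linarith [le_max_left 1 u]
  · obtain rfl := hS.eigenvalues_unique hV
    exact conj_diagonal_comp_eq hS.unitary hV.unitary (fun t => min (κ * u) (max t (max 1 u)))
      (hS.eq.symm.trans hV.eq)

theorem IsGaugeFunctionOf.norm_conj_shrunkEigenvalues_sub {N : ℕ}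
    {ν : Seminorm ℂ (Matrix (Fin N) (Fin N) ℂ)} (hν : IsUnitarilyInvariantNorm ν)
    {g : Seminorm ℝ (Fin N → ℝ)} (hg : IsGaugeFunctionOf ν g) {S U : Matrix (Fin N) (Fin N) ℂ}
    {d : Fin N → ℝ} (hS : IsSpectralDecomposition S U d) (κ u : ℝ) :
    ν (U * Matrix.diagonal (fun i => (shrunkEigenvalues κ d u i : ℂ)) * Uᴴ - S) =
      scalarObjective g κ d u := by
  rw [hS.eq, conj_diagonal_sub,
    hν.invariant _ hS.unitary _ (conjTranspose_mem_unitaryGroup hS.unitary), ← hg.apply_eq]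
  exact (hg.gauge.absolute _).symm

theorem IsGaugeFunctionOf.exists_scalarObjective_le_norm_sub {N : ℕ} (hN : 0 < N)
    {ν : Seminorm ℂ (Matrix (Fin N) (Fin N) ℂ)} (hν : IsUnitarilyInvariantNorm ν)
    {g : Seminorm ℝ (Fin N → ℝ)} (hg : IsGaugeFunctionOf ν g) {S U : Matrix (Fin N) (Fin N) ℂ}
    {d : Fin N → ℝ} (hS : IsSpectralDecomposition S U d) {κ : ℝ} (hκ : 1 ≤ κ)
    {Y : Matrix (Fin N) (Fin N) ℂ} (hY : Y ∈ feasibleMatrices N κ) :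
    ∃ u ∈ Set.Ici (1 / κ), scalarObjective g κ d u ≤ ν (Y - S) := by
  obtain ⟨u, hu1, y, hy⟩ := exists_diag_mem_Icc_of_mem_feasibleMatrices hN hS.unitary hY
  have hu : u ∈ Set.Ici (1 / κ) := by
    rw [Set.mem_Ici, div_le_iff₀ (by linarith)]
    nlinarith
  have hU1 : Uᴴ * U = 1 := (Unitary.mem_iff.1 hS.unitary).1
  have hdiag : (fun i => (Uᴴ * (Y - S) * U) i i) = fun i => ((y i - d i : ℝ) : ℂ) := by
    have hSU : Uᴴ * S * U = Matrix.diagonal (fun i => (d i : ℂ)) := by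
      rw [hS.eq]
      simp only [mul_assoc, hU1, mul_one]
      rw [← mul_assoc, hU1, one_mul]
    ext i
    rw [mul_sub, sub_mul, hSU, Matrix.sub_apply, (hy i).1, Matrix.diagonal_apply_eq]
    simp
  refine ⟨u, hu, ?_⟩
  calc scalarObjective g κ d u ≤ g fun i => y i - d i := by
        rw [scalarObjective_eq g hκ d hu, max_eq_right hu1]
        refine hg.gauge.mono fun i => ?_
        obtain ⟨h1, h2⟩ := (hy i).2
        rw [abs_of_nonneg (le_max_left _ _)]
        refine max_le (abs_nonneg _) (max_le ?_ ?_)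
        · linarith [neg_abs_le (y i - d i)]
        · linarith [le_abs_self (y i - d i)]
    _ = ν (Matrix.diagonal fun i => (Uᴴ * (Y - S) * U) i i) := by rw [hg.apply_eq, hdiag]
    _ ≤ ν (Uᴴ * (Y - S) * U) := hν.diagonal_diag_le _
    _ = ν (Y - S) := hν.invariant _ (conjTranspose_mem_unitaryGroup hS.unitary) _ hS.unitary _

theorem theorem1 {N : ℕ} (hN : 0 < N)
    (ν : Seminorm ℂ (Matrix (Fin N) (Fin N) ℂ)) (hν : IsUnitarilyInvariantNorm ν)
    (κ : ℝ) (hκ : 1 ≤ κ) :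
    (∃! g : Seminorm ℝ (Fin N → ℝ), IsGaugeFunctionOf ν g) ∧
    ∀ g : Seminorm ℝ (Fin N → ℝ), IsGaugeFunctionOf ν g →
    ∀ (S U : Matrix (Fin N) (Fin N) ℂ) (d : Fin N → ℝ),
      S.PosSemidef → IsSpectralDecomposition S U d →
      ConvexOn ℝ (Set.Ici (1 / κ)) (scalarObjective g κ d) ∧
      (∃ u, IsLeast (scalarSolutions g κ d) u) ∧
      ∀ u, IsLeast (scalarSolutions g κ d) u →
        IsProjectionSolution ν κ S
          (U * Matrix.diagonal (fun i => (shrunkEigenvalues κ d u i : ℂ)) * Uᴴ) ∧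
        IsShrinkageEstimate S
          (U * Matrix.diagonal (fun i => (shrunkEigenvalues κ d u i : ℂ)) * Uᴴ) := by
  refine ⟨existsUnique_isGaugeFunctionOf hν, fun g hg S U d _ hS =>
    ⟨convexOn_scalarObjective hg.gauge hκ d, exists_isLeast_scalarSolutions hN hg.gauge hκ d,
      fun u hu => ⟨⟨?_, ?_⟩, isShrinkageEstimate_shrunkEigenvalues hS hκ hu.1.1⟩⟩⟩
  -- The lower end is `max 1 u`, not `u`, since the minimizer may lie below `1`.
  · refine conj_diagonal_mem_feasibleMatrices hN hS.unitary (le_max_left 1 u)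
      (shrunkEigenvalues_mem_Icc hκ hu.1.1 d) ?_
    gcongr
    exact le_max_right _ _
  · intro Y hY
    obtain ⟨v, hv, hle⟩ := hg.exists_scalarObjective_le_norm_sub hN hν hS hκ hY
    have hmin : scalarObjective g κ d u ≤ scalarObjective g κ d v := hu.1.2 hv
    exact (hg.norm_conj_shrunkEigenvalues_sub hν hS κ u).trans_le (hmin.trans hle)
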